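/- **Setting.** A *self-similar system* $\Phi$ on a complete metric space $(X,d)$ is a finite set of maps $\varphi:X\to X$, each satisfying $d(\varphi(x),\varphi(y))=\lambda_\varphi\,d(x,y)$ for all $x,y\in X$, with a scaling ratio $\lambda_\varphi\in(0,1)$. Its scaling ratios are *arithmetically related* if the subgroup of the multiplicative group $(0,\infty)$ generated by $\{\lambda_\varphi\}_{\varphi\in\Phi}$ is discrete. Its *scaling zeta function* is the meromorphic function on $\mathbb C$ given by $\zeta_\Phi(s)=\bigl(1-\sum_{\varphi\in\Phi}\lambda_\varphi^{\,s}\bigr)^{-1}$. For $\delta>0$ and $R:(0,\infty)\to\mathbb R$ let $\zeta_R(s)=\zeta_R(s;\delta)=\int_0^\delta t^{s-1}R(t)\,dt$ be the truncated Mellin transform. Write $\mathbb H_a=\{s\in\mathbb C:\operatorname{Re}s>a\}$, $a\in[-\infty,\infty)$. A *screen* is a bounded Lipschitz function $S:\mathbb R\to\mathbb R$, identified with the curve $\{S(\tau)+i\tau:\tau\in\mathbb R\}$; its *window* is $W=\{s:\operatorname{Re}s\ge S(\operatorname{Im}s)\}$. A function $f$ *extends to* $S$ if it is holomorphic in some half-plane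 $\mathbb H_D\subseteq W$ and has an analytic continuation from there to a neighbourhood of $W$ minus a discrete set of singular points (with no accumulation point in the neighbourhood), none of them on the screen; the continuation is again denoted by $f$. *Admissible heights* are real numbers $(\tau_n)_{n\in\mathbb Z}$ with $\tau_n\to\pm\infty$ as $n\to\pm\infty$ and $\tau_{-n}<0<\tau_n$ for all $n\ge1$. Such an $f$ satisfies, with exponent $0$ and with respect to $S$, * **L1** with the heights $(\tau_n)$, if there are $C>0$ and $\beta>D$ such that for every $n\in\mathbb Z$ and $x\in[S(\tau_n),\beta]$, $f$ is holomorphic at $x+i\tau_n$ and $|f(x+i\tau_n)|\le C$; * **L2**, if there is $C>0$ such that $|f(S(\tau)+i\tau)|\le C$ for all $|\tau|\ge1$. Let $\zeta_R(\cdot;\delta)$ converge and be holomorphic in some right half-plane, and let $\mathbb H_{a}$ be the largest right half-plane to which both $\zeta_\Phi$ and $\zeta_R$ continue analytically up to a discrete set of singular points. A screen $S$ is *admissible* for $R$ and $\Phi$ (with truncation $\delta$) if it is contained in $\mathbb H_{a}$, both $\zeta_\Phi$ and $\zeta_R$ satisfy L1 with respect to $S$ with exponent $0$ and with one common sequence of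 admissible heights, and both satisfy L2 with respect to $S$ with exponent $0$. **Theorem (Lattice Criterion for Admissibility).** Let $\Phi$ be a self-similar system whose scaling ratios are arithmetically related, and let $R:(0,\infty)\to\mathbb R$ be continuous with $R(t)=O(t^{-\sigma_0})$ as $t\to0^+$, for some $\sigma_0\in\mathbb R$. Then for all but finitely many $\sigma>\sigma_0$ the constant screen $S_\sigma(\tau)\equiv\sigma$ is admissible for $R$ and $\Phi$, for every truncation $\delta>0$. Consequently, there is $\varepsilon_0>0$ such that for all $0<\varepsilon<\varepsilon_0$ the screen $S_{\sigma_0+\varepsilon}$ is admissible, for every $\delta>0$. -/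

import Mathlib

open Set Filter Topology MeasureTheory Asymptotics

noncomputable section

/-- A self-similar system on a metric space: a finite set of maps, each of which is a
similitude with scaling ratio in `(0, 1)`. (Values of `ratio` off `maps` are irrelevant.) -/
structure SelfSimilarSystem (X : Type*) [MetricSpace X] where
  maps : Finset (X → X)
  ratio : (X → X) → ℝ
  ratio_pos : ∀ φ ∈ maps, 0 < ratio φ
  ratio_lt_one : ∀ φ ∈ maps, ratio φ < 1
  dist_map : ∀ φ ∈ maps, ∀ x y : X, dist (φ x) (φ y) = ratio φ * dist x y

namespace SelfSimilarSystem

variable {X : Type*} [MetricSpace X]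

/-- The multiplicative group of positive reals generated by the scaling ratios. -/
def ratioGroup (Φ : SelfSimilarSystem X) : Subgroup {x : ℝ // 0 < x} :=
  Subgroup.closure {x | ∃ φ ∈ Φ.maps, (x : ℝ) = Φ.ratio φ}

/-- The lattice case: the group generated by the scaling ratios is discrete. -/
def ArithmeticallyRelated (Φ : SelfSimilarSystem X) : Prop :=
  DiscreteTopology Φ.ratioGroup

/-- The scaling zeta function `ζ_Φ(s) = 1 / (1 - ∑ λ_φ ^ s)`. (It is meromorphic on `ℂ`; the value
`0` which Lean gives it at a zero of the denominator is never used, see `ExtendsToScreen`.) -/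
def scalingZeta (Φ : SelfSimilarSystem X) (s : ℂ) : ℂ :=
  1 / (1 - ∑ φ ∈ Φ.maps, (Φ.ratio φ : ℂ) ^ s)

end SelfSimilarSystem

/-- The truncated Mellin transform `∫_0^δ t^(s-1) R(t) dt`. -/
def truncatedMellin (δ : ℝ) (R : ℝ → ℝ) (s : ℂ) : ℂ :=
  ∫ t in Ioc (0 : ℝ) δ, (t : ℂ) ^ (s - 1) * (R t : ℂ)

/-- The integral defining the truncated Mellin transform at `s` is (absolutely) convergent. -/
def TruncatedMellinConvergent (δ : ℝ) (R : ℝ → ℝ) (s : ℂ) : Prop :=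
  IntegrableOn (fun t : ℝ => (t : ℂ) ^ (s - 1) * (R t : ℂ)) (Ioc (0 : ℝ) δ)

/-- The open right half-plane `Re s > a`, where `a ∈ [-∞, ∞]`. -/
def halfPlane (a : EReal) : Set ℂ := {s | a < (s.re : EReal)}

/-- `F` is holomorphic on the open set `U` except for a set of singular points that is discrete
and has no accumulation point in `U`. -/
def HolomorphicOffDiscrete (F : ℂ → ℂ) (U : Set ℂ) : Prop :=
  ∀ z ∈ U, ∀ᶠ w in 𝓝[≠] z, AnalyticAt ℂ F w

/-- A screen is a bounded, Lipschitz continuous function `S : ℝ → ℝ`. -/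
def IsScreen (S : ℝ → ℝ) : Prop :=
  (∃ M : ℝ, ∀ τ, |S τ| ≤ M) ∧ ∃ K : NNReal, LipschitzWith K S

/-- The point `S(τ) + iτ` of the screen. -/
def screenPoint (S : ℝ → ℝ) (τ : ℝ) : ℂ := ⟨S τ, τ⟩

/-- The window associated to a screen. -/
def window (S : ℝ → ℝ) : Set ℂ := {s | S s.im ≤ s.re}

/-- `F` is an analytic continuation of `f`, given as a holomorphic function on the half-plane
`Re s > D`, to a neighbourhood of the window of `S`, with a discrete set of singular points,
none of which lies on the screen. The half-plane is contained in the window. -/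
structure ExtendsToScreen (f F : ℂ → ℂ) (D : ℝ) (S : ℝ → ℝ) : Prop where
  holomorphic : DifferentiableOn ℂ f (halfPlane D)
  eqOn : EqOn F f (halfPlane D)
  halfPlane_subset : halfPlane D ⊆ window S
  extends_window : ∃ U : Set ℂ, IsOpen U ∧ window S ⊆ U ∧ HolomorphicOffDiscrete F U
  analyticAt_screen : ∀ τ : ℝ, AnalyticAt ℂ F (screenPoint S τ)

/-- A sequence of admissible heights. -/
structure IsAdmissibleHeights (T : ℤ → ℝ) : Prop where
  tendsto_top : Tendsto T atTop atTop
  tendsto_bot : Tendsto T atBot atBot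
  pos : ∀ n : ℤ, 1 ≤ n → 0 < T n
  neg : ∀ n : ℤ, 1 ≤ n → T (-n) < 0

/-- Languidity hypothesis **L1** for `f` with exponent `κ`, with respect to the screen `S`, using
the sequence of heights `T`: no singular point lies on the contours `[S(τ_n), β] + i τ_n`, and the
continuation of `f` is at most `C (|τ_n| + 1) ^ κ` there. -/
def LanguidL1 (κ : ℝ) (f : ℂ → ℂ) (S : ℝ → ℝ) (T : ℤ → ℝ) : Prop :=
  IsAdmissibleHeights T ∧
  ∃ (F : ℂ → ℂ) (D : ℝ), ExtendsToScreen f F D S ∧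
    ∃ C > (0 : ℝ), ∃ β > D, ∀ n : ℤ, ∀ x ∈ Icc (S (T n)) β,
      AnalyticAt ℂ F ⟨x, T n⟩ ∧ ‖F ⟨x, T n⟩‖ ≤ C * (|T n| + 1) ^ κ

/-- Languidity hypothesis **L2** for `f` with exponent `κ`, with respect to the screen `S`. -/
def LanguidL2 (κ : ℝ) (f : ℂ → ℂ) (S : ℝ → ℝ) : Prop :=
  ∃ (F : ℂ → ℂ) (D : ℝ), ExtendsToScreen f F D S ∧
    ∃ C > (0 : ℝ), ∀ τ : ℝ, 1 ≤ |τ| → ‖F (screenPoint S τ)‖ ≤ C * |τ| ^ κ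

/-- `f`, which is holomorphic in some right half-plane, has an analytic continuation to the
half-plane `Re s > a`, except for a discrete set of singular points. -/
def ExtendsToHalfPlane (f : ℂ → ℂ) (a : EReal) : Prop :=
  ∃ (F : ℂ → ℂ) (D : ℝ), DifferentiableOn ℂ f (halfPlane D) ∧ EqOn F f (halfPlane D) ∧
    HolomorphicOffDiscrete F (halfPlane a)

/-- The abscissa in `[-∞, ∞)` of the half-plane of maximal joint extension of `f` and `g`: the
largest right half-plane to which both functions extend. -/
def maxJointAbscissa (f g : ℂ → ℂ) : EReal :=
  sInf {a : EReal | a < ⊤ ∧ ExtendsToHalfPlane f a ∧ ExtendsToHalfPlane g a}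

/-- `f` and `g` are jointly languid with exponent `κ` with respect to the screen `S`. -/
structure JointlyLanguid (κ : ℝ) (f g : ℂ → ℂ) (S : ℝ → ℝ) : Prop where
  holomorphic : ∃ σ₁ : ℝ,
    DifferentiableOn ℂ f (halfPlane σ₁) ∧ DifferentiableOn ℂ g (halfPlane σ₁)
  isScreen : IsScreen S
  screen_subset : ∀ τ : ℝ, screenPoint S τ ∈ halfPlane (maxJointAbscissa f g)
  languidL1 : ∃ T : ℤ → ℝ, LanguidL1 κ f S T ∧ LanguidL1 κ g S T
  languidL2 : LanguidL2 κ f S ∧ LanguidL2 κ g S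

/-- `S` is an admissible screen for the remainder `R` and the self-similar system `Φ`, where
`ζ_R` is the Mellin transform truncated at `δ`: this transform converges and is holomorphic in some
right half-plane, and `ζ_Φ` and `ζ_R` are jointly languid with exponent `0` with respect to `S`. -/
def IsAdmissibleScreen {X : Type*} [MetricSpace X] (δ : ℝ) (R : ℝ → ℝ)
    (Φ : SelfSimilarSystem X) (S : ℝ → ℝ) : Prop :=
  (∃ a : ℝ, (∀ s ∈ halfPlane a, TruncatedMellinConvergent δ R s) ∧
    DifferentiableOn ℂ (truncatedMellin δ R) (halfPlane a)) ∧
  JointlyLanguid 0 Φ.scalingZeta (truncatedMellin δ R) S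

end

/-! Write `ζ_Φ = 1/g` with `g` entire. A discrete group of positive reals is cyclic, so the `log
λ_φ` are integer multiples of one real `c`, and `g` has an imaginary period `ip`. Since `g → 1` as
`Re s → ∞`, the zeros with `Re s > σ₀` lie, modulo the period, in a compact rectangle. They are
therefore finitely many modulo `ip`, with finitely many real parts. For any other `σ > σ₀`,
periodicity and compactness bound `1/g` on the line `Re s = σ` (L2), and also on horizontal segments
at heights `τ + np`, with `τ` avoiding the imaginary parts of the zeros (L1). The transform of `R`
is holomorphic for `Re s > σ₀` and bounded on closed vertical strips there, so it accepts the same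
heights. -/

theorem mem_halfPlane {a : ℝ} {s : ℂ} : s ∈ halfPlane (a : EReal) ↔ a < s.re :=
  EReal.coe_lt_coe_iff

theorem isOpen_halfPlane (a : ℝ) : IsOpen (halfPlane (a : EReal)) := by
  simpa only [halfPlane, EReal.coe_lt_coe_iff] using isOpen_lt continuous_const Complex.continuous_re

/-! ### Zeros of entire functions with an imaginary period -/

/-- Infinitely many zeros would accumulate in `K`, against the identity theorem. -/
theorem Differentiable.finite_zeros_of_isCompact {g : ℂ → ℂ} (hg : Differentiable ℂ g) {z₁ : ℂ}
    (hz₁ : g z₁ ≠ 0) {K : Set ℂ} (hK : IsCompact K) : {z ∈ K | g z = 0}.Finite := by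
  by_contra h
  obtain ⟨z₀, -, hz₀⟩ := Set.Infinite.exists_accPt_of_subset_isCompact h hK (sep_subset _ _)
  rw [accPt_iff_frequently_nhdsNE] at hz₀
  exact hz₁ ((Complex.analyticOnNhd_univ_iff_differentiable.2
    hg).eqOn_zero_of_preconnected_of_frequently_eq_zero isPreconnected_univ (mem_univ z₀) (hz₀.mono fun _ hz => hz.2) (mem_univ z₁))

theorem Differentiable.analyticAt_one_div {g : ℂ → ℂ} (hg : Differentiable ℂ g) {z : ℂ}
    (hz : g z ≠ 0) : AnalyticAt ℂ (fun s => 1 / g s) z :=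
  analyticAt_const.div (hg.analyticAt z) hz

theorem Differentiable.holomorphicOffDiscrete_one_div {g : ℂ → ℂ} (hg : Differentiable ℂ g)
    {z₁ : ℂ} (hz₁ : g z₁ ≠ 0) (U : Set ℂ) : HolomorphicOffDiscrete (fun s => 1 / g s) U := by
  intro z _
  have hne : ∀ᶠ w in 𝓝[≠] z, g w ≠ 0 := by
    by_contra h
    exact hz₁ ((Complex.analyticOnNhd_univ_iff_differentiable.2
      hg).eqOn_zero_of_preconnected_of_frequently_eq_zero isPreconnected_univ (mem_univ z)
      h (mem_univ z₁))
  exact hne.mono fun w hw => hg.analyticAt_one_div hw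

theorem periodic_re_im {g : ℂ → ℂ} {p : ℝ} (hp : Function.Periodic g (p * Complex.I)) (x : ℝ) :
    Function.Periodic (fun τ : ℝ => g ⟨x, τ⟩) p := by
  intro τ
  have h : (⟨x, τ + p⟩ : ℂ) = ⟨x, τ⟩ + p * Complex.I := by
    apply Complex.ext <;> simp
  simpa only [h] using hp ⟨x, τ⟩

/-- An imaginary-periodic entire function which has no zeros far to the right has only finitely
many real parts of zeros in a right half-plane. -/
theorem Differentiable.finite_re_zeros_of_periodic {g : ℂ → ℂ} (hg : Differentiable ℂ g) {p : ℝ}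
    (hp₀ : 0 < p) (hp : Function.Periodic g (p * Complex.I)) {D : ℝ}
    (hD : ∀ s : ℂ, D < s.re → g s ≠ 0) (a : ℝ) :
    {x : ℝ | a < x ∧ ∃ τ : ℝ, g ⟨x, τ⟩ = 0}.Finite := by
  have hz₁ : g ((D + 1 : ℝ) : ℂ) ≠ 0 := hD _ (by simp)
  refine ((hg.finite_zeros_of_isCompact hz₁ ((isCompact_Icc (a := a) (b := D)).reProdIm
    (isCompact_Icc (a := 0) (b := p)))).image Complex.re).subset ?_
  rintro x ⟨hax, τ, hτ⟩
  obtain ⟨τ', hτ', h⟩ := (periodic_re_im hp x).exists_mem_Ico₀ hp₀ τ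
  have h0 : g ⟨x, τ'⟩ = 0 := h ▸ hτ
  refine ⟨⟨x, τ'⟩, ⟨?_, h0⟩, rfl⟩
  refine ⟨⟨hax.le, ?_⟩, hτ'.1, hτ'.2.le⟩
  by_contra hx
  exact hD ⟨x, τ'⟩ (not_le.1 hx) h0

/-- Some horizontal segment over `[a, b]`, at a height inside one period, avoids all zeros. -/
theorem Differentiable.exists_height_forall_ne_zero {g : ℂ → ℂ} (hg : Differentiable ℂ g)
    {z₁ : ℂ} (hz₁ : g z₁ ≠ 0) {p : ℝ} (hp₀ : 0 < p) (a b : ℝ) :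
    ∃ τ ∈ Ioo 0 p, ∀ x ∈ Icc a b, g ⟨x, τ⟩ ≠ 0 := by
  obtain ⟨τ, hτ, hτ'⟩ := (Ioo_infinite hp₀).exists_notMem_finite
    ((hg.finite_zeros_of_isCompact hz₁ ((isCompact_Icc (a := a) (b := b)).reProdIm
      (isCompact_Icc (a := 0) (b := p)))).image Complex.im)
  exact ⟨τ, hτ, fun x hx h0 => hτ' ⟨⟨x, τ⟩, ⟨⟨hx, hτ.1.le, hτ.2.le⟩, h0⟩, rfl⟩⟩

theorem exists_bound_one_div {g : ℂ → ℂ} (hg : Continuous g) {K : Set ℂ} (hK : IsCompact K)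
    (h0 : ∀ z ∈ K, g z ≠ 0) : ∃ C > (0 : ℝ), ∀ z ∈ K, ‖1 / g z‖ ≤ C := by
  obtain ⟨C, hC⟩ := hK.exists_bound_of_continuousOn
    (f := fun z => 1 / g z) (continuousOn_const.div hg.continuousOn h0)
  exact ⟨max C 1, by positivity, fun z hz => (hC z hz).trans (le_max_left _ _)⟩

/-- The bound `τ < p` makes `τ - np` negative already at `n = 1`. -/
theorem isAdmissibleHeights_arithmetic {τ p : ℝ} (hτ : τ ∈ Ioo 0 p) :
    IsAdmissibleHeights fun n : ℤ => τ + n * p := by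
  have hp : 0 < p := hτ.1.trans hτ.2
  refine ⟨?_, ?_, fun n hn => ?_, fun n hn => ?_⟩
  · exact tendsto_atTop_add_const_left _ _ (tendsto_intCast_atTop_atTop.atTop_mul_const hp)
  · exact tendsto_atBot_add_const_left _ _
      ((tendsto_intCast_atBot_iff.2 tendsto_id).atBot_mul_const hp)
  · have : (1 : ℝ) ≤ n := by exact_mod_cast hn
    have := hτ.1
    positivity
  · have : (1 : ℝ) ≤ n := by exact_mod_cast hn
    have h : p ≤ n * p := le_mul_of_one_le_left hp.le this
    have := hτ.2
    push_cast
    linarith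

theorem isScreen_const (σ : ℝ) : IsScreen fun _ => σ :=
  ⟨⟨|σ|, fun _ => le_rfl⟩, 0, LipschitzWith.const σ⟩

/-! ### Languidity of the reciprocal of a periodic entire function -/

section ReciprocalOfPeriodic

variable {g : ℂ → ℂ} {D : ℝ}

theorem extendsToScreen_one_div (hg : Differentiable ℂ g) (hD : ∀ s : ℂ, D < s.re → g s ≠ 0)
    {σ : ℝ} (hσ : ∀ τ : ℝ, g ⟨σ, τ⟩ ≠ 0) :
    -- The maximum puts the half-plane both in the zero-free region and in the window.
    ExtendsToScreen (fun s => 1 / g s) (fun s => 1 / g s) (max D σ : ℝ) fun _ => σ where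
  holomorphic s hs := by
    rw [mem_halfPlane] at hs
    exact (hg.analyticAt_one_div
      (hD s ((le_max_left _ _).trans_lt hs))).differentiableAt.differentiableWithinAt
  eqOn _ _ := rfl
  halfPlane_subset s hs := by
    rw [mem_halfPlane] at hs
    exact ((le_max_right _ _).trans_lt hs).le
  extends_window := ⟨univ, isOpen_univ, subset_univ _,
    hg.holomorphicOffDiscrete_one_div (hσ 0) _⟩
  analyticAt_screen τ := hg.analyticAt_one_div (hσ τ)

theorem exists_heights_languidL1_one_div (hg : Differentiable ℂ g)
    (hD : ∀ s : ℂ, D < s.re → g s ≠ 0) {p : ℝ} (hp₀ : 0 < p)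
    (hp : Function.Periodic g (p * Complex.I)) {σ : ℝ} (hσ : ∀ τ : ℝ, g ⟨σ, τ⟩ ≠ 0) :
    ∃ T : ℤ → ℝ, LanguidL1 0 (fun s => 1 / g s) (fun _ => σ) T := by
  set β := max D σ + 1
  obtain ⟨τ, hτ, h0⟩ := hg.exists_height_forall_ne_zero (hσ 0) hp₀ σ β
  have hper : ∀ (x : ℝ) (n : ℤ), g ⟨x, τ + n * p⟩ = g ⟨x, τ⟩ := fun x n => by
    simpa using (periodic_re_im hp x).zsmul n τ
  obtain ⟨C, hC, hbound⟩ := exists_bound_one_div hg.continuous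
    ((isCompact_Icc (a := σ) (b := β)).reProdIm (isCompact_singleton (x := τ)))
    (fun z hz => by
      have := h0 z.re hz.1
      rwa [show (⟨z.re, τ⟩ : ℂ) = z from Complex.ext rfl (Eq.symm hz.2)] at this)
  refine ⟨fun n => τ + n * p, isAdmissibleHeights_arithmetic hτ, _, _,
    extendsToScreen_one_div hg hD hσ, C, hC, β, lt_add_one _, fun n x hx => ⟨?_, ?_⟩⟩
  · refine hg.analyticAt_one_div ?_
    rw [hper]
    exact h0 x hx
  · simp only [hper, Real.rpow_zero, mul_one]
    exact hbound ⟨x, τ⟩ ⟨hx, rfl⟩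

theorem languidL2_one_div (hg : Differentiable ℂ g)
    (hD : ∀ s : ℂ, D < s.re → g s ≠ 0) {p : ℝ} (hp₀ : 0 < p)
    (hp : Function.Periodic g (p * Complex.I)) {σ : ℝ} (hσ : ∀ τ : ℝ, g ⟨σ, τ⟩ ≠ 0) :
    LanguidL2 0 (fun s => 1 / g s) fun _ => σ := by
  obtain ⟨C, hC, hbound⟩ := exists_bound_one_div hg.continuous
    ((isCompact_singleton (x := σ)).reProdIm (isCompact_Icc (a := 0) (b := p)))
    (fun z hz => by
      have := hσ z.im
      rwa [show (⟨σ, z.im⟩ : ℂ) = z from Complex.ext (Eq.symm hz.1) rfl] at this)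
  refine ⟨_, _, extendsToScreen_one_div hg hD hσ, C, hC, fun τ _ => ?_⟩
  obtain ⟨τ', hτ', h⟩ := (periodic_re_im hp σ).exists_mem_Ico₀ hp₀ τ
  simp only [screenPoint, Real.rpow_zero, mul_one]
  rw [h]
  exact hbound ⟨σ, τ'⟩ ⟨rfl, hτ'.1, hτ'.2.le⟩

end ReciprocalOfPeriodic

/-! ### The scaling zeta function in the lattice case -/

/-- With `mulArchimedean_posReal`, this allows `Subgroup.discrete_iff_cyclic` to be applied to the
ratio group. -/
theorem orderTopology_posReal : OrderTopology {x : ℝ // 0 < x} :=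
  orderTopology_of_ordConnected (t := Ioi (0 : ℝ))

theorem mulArchimedean_posReal : MulArchimedean {x : ℝ // 0 < x} where
  arch x y hy := by
    obtain ⟨n, hn⟩ := pow_unbounded_of_one_lt (x : ℝ) (show (1 : ℝ) < y from hy)
    exact ⟨n, hn.le⟩

namespace SelfSimilarSystem

variable {X : Type*} [MetricSpace X] (Φ : SelfSimilarSystem X)

/-- The denominator of the scaling zeta function. -/
noncomputable def scalingDenominator (s : ℂ) : ℂ :=
  1 - ∑ φ ∈ Φ.maps, (Φ.ratio φ : ℂ) ^ s

theorem differentiable_scalingDenominator : Differentiable ℂ Φ.scalingDenominator := by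
  refine (differentiable_const _).sub (Differentiable.fun_sum fun φ hφ => ?_)
  exact differentiable_id.const_cpow (Or.inl (by exact_mod_cast (Φ.ratio_pos φ hφ).ne'))

/-- As `|λ ^ s| = λ ^ Re s` and every `λ < 1`, the sum has modulus below `1` far to the right. -/
theorem exists_forall_scalingDenominator_ne_zero :
    ∃ D : ℝ, ∀ s : ℂ, D < s.re → Φ.scalingDenominator s ≠ 0 := by
  have ht : Tendsto (fun x : ℝ => ∑ φ ∈ Φ.maps, Φ.ratio φ ^ x) atTop (𝓝 0) := by
    simpa using tendsto_finsetSum Φ.maps fun φ hφ => tendsto_rpow_atTop_of_base_lt_one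
      (Φ.ratio φ) (by linarith [Φ.ratio_pos φ hφ]) (Φ.ratio_lt_one φ hφ)
  obtain ⟨D, hD⟩ := eventually_atTop.1 (ht.eventually_lt_const one_pos)
  refine ⟨D, fun s hs h => ?_⟩
  have hone : ∑ φ ∈ Φ.maps, (Φ.ratio φ : ℂ) ^ s = 1 := (sub_eq_zero.1 h).symm
  have hle : ‖∑ φ ∈ Φ.maps, (Φ.ratio φ : ℂ) ^ s‖ ≤ ∑ φ ∈ Φ.maps, Φ.ratio φ ^ s.re :=
    norm_sum_le_of_le _ fun φ hφ => (Complex.norm_cpow_eq_rpow_re_of_pos (Φ.ratio_pos φ hφ) s).le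
  rw [hone, norm_one] at hle
  exact absurd (hD s.re hs.le) (not_lt.2 hle)

variable {Φ}

/-- In the lattice case, the logarithms of the scaling ratios are integer multiples of one real. -/
theorem ArithmeticallyRelated.exists_log_eq (hΦ : Φ.ArithmeticallyRelated) :
    ∃ c : ℝ, ∀ φ ∈ Φ.maps, ∃ k : ℤ, Real.log (Φ.ratio φ) = k * c := by
  have := orderTopology_posReal
  have := mulArchimedean_posReal
  obtain ⟨g, hg⟩ := (Subgroup.isCyclic_iff_exists_zpowers_eq_top _).1
    (Subgroup.discrete_iff_cyclic.2 hΦ)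
  refine ⟨Real.log g, fun φ hφ => ?_⟩
  have hmem : (⟨Φ.ratio φ, Φ.ratio_pos φ hφ⟩ : {x : ℝ // 0 < x}) ∈ Φ.ratioGroup :=
    Subgroup.subset_closure ⟨φ, hφ, rfl⟩
  rw [← hg] at hmem
  obtain ⟨k, hk⟩ := hmem
  refine ⟨k, ?_⟩
  rw [← Real.log_zpow]
  exact congrArg (fun y : {x : ℝ // 0 < x} => Real.log y) hk.symm

/-- In the lattice case, the scaling zeta function has an imaginary period. -/
theorem ArithmeticallyRelated.exists_periodic (hΦ : Φ.ArithmeticallyRelated) :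
    ∃ p : ℝ, 0 < p ∧ Function.Periodic Φ.scalingDenominator (p * Complex.I) := by
  obtain ⟨c, hc⟩ := hΦ.exists_log_eq
  -- Take `p = 2π/|c|`. If `c = 0`, there are no maps, since every `log λ_φ < 0`; any period then
  -- works.
  obtain ⟨p, hp, m, hm⟩ : ∃ p : ℝ, 0 < p ∧ ∃ m : ℤ, c * p = m * (2 * Real.pi) := by
    rcases lt_trichotomy c 0 with h | rfl | h
    · exact ⟨2 * Real.pi / (-c), by have := neg_pos.2 h; positivity, -1, by
        have := h.ne
        field_simp; simp⟩
    · exact ⟨1, one_pos, 0, by simp⟩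
    · exact ⟨2 * Real.pi / c, by positivity, 1, by field_simp; simp⟩
  refine ⟨p, hp, fun s => ?_⟩
  unfold scalingDenominator
  congr 1
  refine Finset.sum_congr rfl fun φ hφ => ?_
  have h0 : (Φ.ratio φ : ℂ) ≠ 0 := by exact_mod_cast (Φ.ratio_pos φ hφ).ne'
  obtain ⟨k, hk⟩ := hc φ hφ
  rw [Complex.cpow_add _ _ h0, Complex.cpow_def_of_ne_zero h0 (p * Complex.I),
    ← Complex.ofReal_log (Φ.ratio_pos φ hφ).le, hk]
  have : ((k * c : ℝ) : ℂ) * (p * Complex.I) = (k * m : ℤ) * (2 * Real.pi * Complex.I) := by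
    have hm' : (c : ℂ) * p = m * (2 * Real.pi) := by exact_mod_cast hm
    push_cast
    linear_combination (k * Complex.I) * hm'
  rw [this, Complex.exp_int_mul_two_pi_mul_I, mul_one]

end SelfSimilarSystem

/-! ### The truncated Mellin transform -/

section TruncatedMellin

variable {δ σ₀ : ℝ} {R : ℝ → ℝ}

/-- Extending `R` by zero beyond `δ` gives a full Mellin transform; decay at infinity is then
automatic, and only the growth at `0` limits convergence. -/
theorem truncatedMellin_eq_mellin (δ : ℝ) (R : ℝ → ℝ) :
    truncatedMellin δ R = mellin ((Ioc 0 δ).indicator fun t => (R t : ℂ)) := by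
  funext s
  simp_rw [truncatedMellin, mellin, ← indicator_smul]
  rw [setIntegral_indicator measurableSet_Ioc, inter_eq_right.2 Ioc_subset_Ioi_self]
  rfl

theorem truncatedMellinConvergent_iff (δ : ℝ) (R : ℝ → ℝ) (s : ℂ) :
    TruncatedMellinConvergent δ R s ↔
      MellinConvergent ((Ioc 0 δ).indicator fun t => (R t : ℂ)) s := by
  simp_rw [MellinConvergent, ← indicator_smul]
  rw [IntegrableOn, integrable_indicator_iff measurableSet_Ioc, IntegrableOn,
    Measure.restrict_restrict_of_subset Ioc_subset_Ioi_self]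
  rfl

theorem locallyIntegrableOn_truncation (hR : ContinuousOn R (Ioi 0)) (δ : ℝ) :
    LocallyIntegrableOn ((Ioc 0 δ).indicator fun t => (R t : ℂ)) (Ioi 0) := by
  have h : LocallyIntegrableOn (fun t => (R t : ℂ)) (Ioi 0) :=
    (Complex.continuous_ofReal.comp_continuousOn hR).locallyIntegrableOn measurableSet_Ioi
  intro t ht
  obtain ⟨u, hu, hi⟩ := h t ht
  exact ⟨u, hu, hi.indicator measurableSet_Ioc⟩

theorem truncation_isBigO_atTop (δ : ℝ) (R : ℝ → ℝ) (a : ℝ) :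
    ((Ioc 0 δ).indicator fun t => (R t : ℂ)) =O[atTop] fun t : ℝ => t ^ (-a) := by
  refine (isBigO_zero _ _).congr' ?_ EventuallyEq.rfl
  filter_upwards [eventually_gt_atTop δ] with t ht
  exact (indicator_of_notMem (fun h => absurd h.2 (not_le.2 ht)) _).symm

theorem truncation_isBigO_zero (hRO : R =O[𝓝[>] (0 : ℝ)] fun t : ℝ => t ^ (-σ₀)) (δ : ℝ) :
    ((Ioc 0 δ).indicator fun t => (R t : ℂ)) =O[𝓝[>] 0] fun t : ℝ => t ^ (-σ₀) := by
  refine (IsBigO.of_norm_le fun t => ?_).trans hRO.norm_left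
  refine (norm_indicator_le_norm_self _ t).trans ?_
  simp

theorem truncatedMellinConvergent_of_isBigO (hR : ContinuousOn R (Ioi 0))
    (hRO : R =O[𝓝[>] (0 : ℝ)] fun t : ℝ => t ^ (-σ₀)) (δ : ℝ) {s : ℂ} (hs : σ₀ < s.re) :
    TruncatedMellinConvergent δ R s :=
  (truncatedMellinConvergent_iff δ R s).2 <| mellinConvergent_of_isBigO_rpow
    (locallyIntegrableOn_truncation hR δ) (truncation_isBigO_atTop δ R (s.re + 1)) (lt_add_one _)
    (truncation_isBigO_zero hRO δ) hs

theorem differentiableOn_truncatedMellin (hR : ContinuousOn R (Ioi 0))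
    (hRO : R =O[𝓝[>] (0 : ℝ)] fun t : ℝ => t ^ (-σ₀)) (δ : ℝ) :
    DifferentiableOn ℂ (truncatedMellin δ R) (halfPlane σ₀) := by
  intro s hs
  rw [truncatedMellin_eq_mellin]
  exact (mellin_differentiableAt_of_isBigO_rpow (locallyIntegrableOn_truncation hR δ)
    (truncation_isBigO_atTop δ R (s.re + 1)) (lt_add_one _) (truncation_isBigO_zero hRO δ)
    (mem_halfPlane.1 hs)).differentiableWithinAt

theorem analyticAt_truncatedMellin (hR : ContinuousOn R (Ioi 0))
    (hRO : R =O[𝓝[>] (0 : ℝ)] fun t : ℝ => t ^ (-σ₀)) (δ : ℝ) {s : ℂ} (hs : σ₀ < s.re) :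
    AnalyticAt ℂ (truncatedMellin δ R) s :=
  (differentiableOn_truncatedMellin hR hRO δ).analyticAt
    ((isOpen_halfPlane σ₀).mem_nhds (mem_halfPlane.2 hs))

/-- The truncated Mellin transform is bounded in vertical strips of its half-plane of
convergence. -/
theorem exists_bound_truncatedMellin (hR : ContinuousOn R (Ioi 0))
    (hRO : R =O[𝓝[>] (0 : ℝ)] fun t : ℝ => t ^ (-σ₀)) (δ : ℝ) {σ : ℝ} (hσ : σ₀ < σ) (β : ℝ) :
    ∃ C > (0 : ℝ), ∀ s : ℂ, s.re ∈ Icc σ β → ‖truncatedMellin δ R s‖ ≤ C := by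
  have hint : IntegrableOn (fun t : ℝ => ‖(t : ℂ) ^ ((σ : ℂ) - 1) * (R t : ℂ)‖) (Ioc 0 δ) :=
    (truncatedMellinConvergent_of_isBigO hR hRO δ (s := (σ : ℂ)) (by simpa using hσ)).norm
  -- Compare with the line `Re s = σ`: the extra factor `t ^ (Re s - σ)` is at most `M` on `(0, δ]`.
  -- The base is at least `1`, so that the power grows with the exponent.
  set M := (max 1 δ) ^ (β - σ)
  refine ⟨max (∫ t in Ioc (0 : ℝ) δ, M * ‖(t : ℂ) ^ ((σ : ℂ) - 1) * (R t : ℂ)‖) 1,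
    by positivity, fun s hs => le_trans ?_ (le_max_left _ _)⟩
  refine norm_integral_le_of_norm_le (hint.const_mul M) ?_
  refine (ae_restrict_iff' measurableSet_Ioc).2 (Eventually.of_forall fun t ht => ?_)
  rw [norm_mul, norm_mul, Complex.norm_cpow_eq_rpow_re_of_pos ht.1,
    Complex.norm_cpow_eq_rpow_re_of_pos ht.1, ← mul_assoc]
  refine mul_le_mul_of_nonneg_right ?_ (norm_nonneg _)
  have hsplit : t ^ (s - 1).re = t ^ (s.re - σ) * t ^ ((σ : ℂ) - 1).re := by
    rw [← Real.rpow_add ht.1]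
    congr 1
    simp
  rw [hsplit]
  refine mul_le_mul_of_nonneg_right ?_ (Real.rpow_nonneg ht.1.le _)
  calc t ^ (s.re - σ) ≤ (max 1 δ) ^ (s.re - σ) :=
        Real.rpow_le_rpow ht.1.le (ht.2.trans (le_max_right _ _)) (sub_nonneg.2 hs.1)
    _ ≤ M := Real.rpow_le_rpow_of_exponent_le (le_max_left _ _) (by linarith [hs.2])

theorem extendsToScreen_truncatedMellin (hR : ContinuousOn R (Ioi 0))
    (hRO : R =O[𝓝[>] (0 : ℝ)] fun t : ℝ => t ^ (-σ₀)) (δ : ℝ) {σ : ℝ} (hσ : σ₀ < σ) :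
    ExtendsToScreen (truncatedMellin δ R) (truncatedMellin δ R) σ fun _ => σ where
  holomorphic := (differentiableOn_truncatedMellin hR hRO δ).mono fun s hs =>
    mem_halfPlane.2 (hσ.trans (mem_halfPlane.1 hs))
  eqOn _ _ := rfl
  halfPlane_subset _ hs := (mem_halfPlane.1 hs).le
  extends_window := by
    refine ⟨halfPlane σ₀, isOpen_halfPlane σ₀, fun s hs => mem_halfPlane.2 (hσ.trans_le hs),
      fun z hz => ?_⟩
    filter_upwards [mem_nhdsWithin_of_mem_nhds ((isOpen_halfPlane σ₀).mem_nhds hz)] with w hw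
    exact analyticAt_truncatedMellin hR hRO δ (mem_halfPlane.1 hw)
  analyticAt_screen τ := analyticAt_truncatedMellin hR hRO δ hσ

theorem languidL1_truncatedMellin (hR : ContinuousOn R (Ioi 0))
    (hRO : R =O[𝓝[>] (0 : ℝ)] fun t : ℝ => t ^ (-σ₀)) (δ : ℝ) {σ : ℝ} (hσ : σ₀ < σ)
    {T : ℤ → ℝ} (hT : IsAdmissibleHeights T) :
    LanguidL1 0 (truncatedMellin δ R) (fun _ => σ) T := by
  obtain ⟨C, hC, hbound⟩ := exists_bound_truncatedMellin hR hRO δ hσ (σ + 1)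
  refine ⟨hT, _, _, extendsToScreen_truncatedMellin hR hRO δ hσ, C, hC, σ + 1, lt_add_one _,
    fun n x hx => ⟨analyticAt_truncatedMellin hR hRO δ (hσ.trans_le hx.1), ?_⟩⟩
  simpa using hbound ⟨x, T n⟩ hx

theorem languidL2_truncatedMellin (hR : ContinuousOn R (Ioi 0))
    (hRO : R =O[𝓝[>] (0 : ℝ)] fun t : ℝ => t ^ (-σ₀)) (δ : ℝ) {σ : ℝ} (hσ : σ₀ < σ) :
    LanguidL2 0 (truncatedMellin δ R) fun _ => σ := by
  obtain ⟨C, hC, hbound⟩ := exists_bound_truncatedMellin hR hRO δ hσ σ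
  refine ⟨_, _, extendsToScreen_truncatedMellin hR hRO δ hσ, C, hC, fun τ _ => ?_⟩
  simpa using hbound (screenPoint (fun _ => σ) τ) ⟨le_rfl, le_rfl⟩

end TruncatedMellin

/-! ### Admissibility of constant screens -/

section Admissibility

variable {X : Type*} [MetricSpace X] {Φ : SelfSimilarSystem X} {R : ℝ → ℝ} {σ₀ : ℝ}

/-- An upper bound suffices, as the screens lie strictly to the right of `σ₀`. -/
theorem maxJointAbscissa_scalingZeta_truncatedMellin_le (hR : ContinuousOn R (Ioi 0))
    (hRO : R =O[𝓝[>] (0 : ℝ)] fun t : ℝ => t ^ (-σ₀)) (δ : ℝ) :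
    maxJointAbscissa Φ.scalingZeta (truncatedMellin δ R) ≤ σ₀ := by
  obtain ⟨D, hD⟩ := Φ.exists_forall_scalingDenominator_ne_zero
  have hg := Φ.differentiable_scalingDenominator
  refine sInf_le ⟨EReal.coe_lt_top _, ⟨Φ.scalingZeta, D, fun s hs => ?_, fun _ _ => rfl, ?_⟩,
    ⟨truncatedMellin δ R, σ₀, differentiableOn_truncatedMellin hR hRO δ, fun _ _ => rfl,
      fun z hz => ?_⟩⟩
  · exact (hg.analyticAt_one_div
      (hD s (mem_halfPlane.1 hs))).differentiableAt.differentiableWithinAt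
  · exact hg.holomorphicOffDiscrete_one_div (hD ((D + 1 : ℝ) : ℂ) (by simp)) _
  · filter_upwards [mem_nhdsWithin_of_mem_nhds ((isOpen_halfPlane σ₀).mem_nhds hz)] with w hw
    exact analyticAt_truncatedMellin hR hRO δ (mem_halfPlane.1 hw)

/-- In the lattice case, a vertical line to the right of `σ₀` which carries no pole of the scaling
zeta function is an admissible screen. -/
theorem isAdmissibleScreen_const (hΦ : Φ.ArithmeticallyRelated) (hR : ContinuousOn R (Ioi 0))
    (hRO : R =O[𝓝[>] (0 : ℝ)] fun t : ℝ => t ^ (-σ₀)) (δ : ℝ) {σ : ℝ} (hσ : σ₀ < σ)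
    (h0 : ∀ τ : ℝ, Φ.scalingDenominator ⟨σ, τ⟩ ≠ 0) :
    IsAdmissibleScreen δ R Φ fun _ => σ := by
  obtain ⟨D, hD⟩ := Φ.exists_forall_scalingDenominator_ne_zero
  obtain ⟨p, hp₀, hp⟩ := hΦ.exists_periodic
  have hg := Φ.differentiable_scalingDenominator
  -- The poles of `ζ_Φ` dictate the common heights.
  obtain ⟨T, hT⟩ := exists_heights_languidL1_one_div hg hD hp₀ hp h0
  refine ⟨⟨σ₀, fun s hs => truncatedMellinConvergent_of_isBigO hR hRO δ (mem_halfPlane.1 hs),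
    differentiableOn_truncatedMellin hR hRO δ⟩, ⟨max D σ, ?_, ?_⟩, isScreen_const σ, fun τ => ?_,
    ⟨T, hT, languidL1_truncatedMellin hR hRO δ hσ hT.1⟩,
    languidL2_one_div hg hD hp₀ hp h0, languidL2_truncatedMellin hR hRO δ hσ⟩
  · exact (extendsToScreen_one_div hg hD h0).holomorphic
  · exact (differentiableOn_truncatedMellin hR hRO δ).mono fun s hs =>
      mem_halfPlane.2 (hσ.trans ((le_max_right _ _).trans_lt (mem_halfPlane.1 hs)))
  · exact (maxJointAbscissa_scalingZeta_truncatedMellin_le hR hRO δ).trans_lt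
      (EReal.coe_lt_coe_iff.2 hσ)

end Admissibility

theorem mainTheorem12 {X : Type*} [MetricSpace X] [CompleteSpace X]
    (Φ : SelfSimilarSystem X) (hΦ : Φ.ArithmeticallyRelated)
    (R : ℝ → ℝ) (hR : ContinuousOn R (Ioi 0)) (σ₀ : ℝ)
    (hRO : R =O[𝓝[>] (0 : ℝ)] fun t : ℝ => t ^ (-σ₀)) :
    {σ : ℝ | σ₀ < σ ∧ ¬ ∀ δ > (0 : ℝ), IsAdmissibleScreen δ R Φ (fun _ => σ)}.Finite ∧
    ∃ ε₀ > (0 : ℝ), ∀ ε : ℝ, 0 < ε → ε < ε₀ →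
      ∀ δ > (0 : ℝ), IsAdmissibleScreen δ R Φ (fun _ => σ₀ + ε) := by
  have hfin : {σ : ℝ | σ₀ < σ ∧
      ¬ ∀ δ > (0 : ℝ), IsAdmissibleScreen δ R Φ (fun _ => σ)}.Finite := by
    obtain ⟨D, hD⟩ := Φ.exists_forall_scalingDenominator_ne_zero
    obtain ⟨p, hp₀, hp⟩ := hΦ.exists_periodic
    refine (Φ.differentiable_scalingDenominator.finite_re_zeros_of_periodic
      hp₀ hp hD σ₀).subset fun σ hσ => ⟨hσ.1, ?_⟩
    by_contra! h0
    exact hσ.2 fun δ _ => isAdmissibleScreen_const hΦ hR hRO δ hσ.1 h0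
  refine ⟨hfin, ?_⟩
  -- The finite exceptional set is closed and omits `σ₀`, so a ball about `σ₀` misses it. It covers
  -- all `δ` at once, hence one `ε₀` serves every truncation.
  obtain ⟨ε₀, hε₀, hball⟩ := Metric.isOpen_iff.1 hfin.isClosed.isOpen_compl σ₀
    fun h => lt_irrefl _ h.1
  refine ⟨ε₀, hε₀, fun ε hε hεε₀ => ?_⟩
  by_contra h
  exact hball (by simpa [abs_of_pos hε] using hεε₀ : σ₀ + ε ∈ Metric.ball σ₀ ε₀)
    ⟨lt_add_of_pos_right _ hε, h⟩
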